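/- Consider a structured linear system $\dot x(t)=[A]x(t)+[B_{def}]u_{def}(t)+[B_{att}]u_{att}(t)$ with $n$ states, where $[A]\in\{0,*\}^{n\times n}$, $[B_{def}]\in\{0,*\}^{n\times d}$, $[B_{att}]\in\{0,*\}^{n\times a}$, each entry being either a fixed zero ($0$) or a free real parameter ($*$, which may also take the value $0$). A pair $([A],[B])$ is *structurally controllable* if there are real matrices $A,B$, vanishing at the fixed zeros of $[A]$ and $[B]$ respectively, such that $\dot x=Ax+Bu$ is controllable, i.e. for every $t_f>0$ every initial state $x(0)$ can be transferred to every final state $x(t_f)$ by some continuous input $u$ on $[0,t_f]$. Let $\mathcal X_{def},\mathcal X_{att}$ be disjoint sets of state vertices such that inputs in $u_{def}$ are connected only to states in $\mathcal X_{def}$ and inputs in $u_{att}$ only to states in $\mathcal X_{att}$; that is, all $*$-entries of $[B_{def}]$ (resp. $[B_{att}]$) lie in rows corresponding to $\mathcal X_{def}$ (resp. $\mathcal X_{att}$). A DoS attack blocks all inputs in $u_{att}$, i.e. replaces $[B_{att}]$ by $0$; the system is *structurally resilient to a DoS attack* if the resulting system $([A],[\,[B_{def}]\;\;0\,])$ is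 structurally controllable. Let $\mathcal D([A])$ be the directed graph on the state vertices $x_1,\dots,x_n$ with an edge $x_j\to x_i$ iff $[A]_{ij}\neq 0$. A strongly connected component (SCC) of it is *non-top-linked* if no edge enters it from a vertex outside it. Let $\mathcal B([A])$ be the bipartite graph with left vertices $s_1,\dots,s_n$ and right vertices $w_1,\dots,w_n$, and an edge $s_j\to w_i$ iff $[A]_{ij}\neq0$; a state $x_i$ is *right-unmatched* in a matching if $w_i$ lies on no edge of the matching. A *maximum matching* is a matching with the largest number of edges. **Theorem.** The system is structurally resilient to a DoS attack if and only if all three of the following hold: 1. $([A],[B_{def}])$ is structurally controllable; 2. there exists a maximum matching of $\mathcal B([A])$ in which no right-unmatched vertex belongs to $\mathcal X_{att}$; 3. $\mathcal D([A])$ has no non-top-linked SCC all of whose vertices belong to $\mathcal X_{att}$. -/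

import Mathlib

open Set

noncomputable section

/-- The two possible entries of a structured matrix: a fixed zero, or a free parameter `*`
(which may take any real value, including `0`). -/
inductive StructEntry : Type
  | zero : StructEntry
  | star : StructEntry

instance : Zero StructEntry := ⟨StructEntry.zero⟩

/-- A structured matrix `[H] ∈ {0,*}^{m × n}`. -/
abbrev StructuredMatrix (m n : Type*) : Type _ := Matrix m n StructEntry

/-- `H` is an admissible numerical realization of `[H]`: it vanishes at every fixed zero of `[H]`,
while its entries at the free parameters are arbitrary. -/
def IsANR {m n : Type*} (Hs : StructuredMatrix m n) (H : Matrix m n ℝ) : Prop :=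
  ∀ i j, Hs i j = 0 → H i j = 0

/-- `x` is a solution of `ẋ(t) = A x(t) + B u(t)` on the time interval `[0, tf]`
(one-sided derivatives at the two end points). -/
def IsTrajectory {X U : Type*} [Fintype X] [Fintype U] (A : Matrix X X ℝ) (B : Matrix X U ℝ)
    (tf : ℝ) (u : ℝ → U → ℝ) (x : ℝ → X → ℝ) : Prop :=
  ∀ t ∈ Icc 0 tf, HasDerivWithinAt x (A.mulVec (x t) + B.mulVec (u t)) (Icc 0 tf) t

/-- Controllability of the linear time-invariant system `ẋ = A x + B u`: on every time interval
`[0, tf]` with `tf > 0`, every initial state can be transferred to every final state by some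
(continuous) input. -/
def Controllable {X U : Type*} [Fintype X] [Fintype U]
    (A : Matrix X X ℝ) (B : Matrix X U ℝ) : Prop :=
  ∀ tf : ℝ, 0 < tf → ∀ x₀ x₁ : X → ℝ, ∃ (u : ℝ → U → ℝ) (x : ℝ → X → ℝ),
    ContinuousOn u (Icc 0 tf) ∧ IsTrajectory A B tf u x ∧ x 0 = x₀ ∧ x tf = x₁

/-- `([A],[B])` is structurally controllable: some admissible numerical realization `(A,B)` is
controllable. -/
def StructurallyControllable {X U : Type*} [Fintype X] [Fintype U]
    (As : StructuredMatrix X X) (Bs : StructuredMatrix X U) : Prop :=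
  ∃ (A : Matrix X X ℝ) (B : Matrix X U ℝ), IsANR As A ∧ IsANR Bs B ∧ Controllable A B

/-- The input structure after a denial-of-service attack. The inputs are `u = (u_def, u_att)`, with
`u_def` indexed by `D` and `u_att` by `T`, and `[B] = [[B_def] [B_att]]`. The attack blocks all
inputs in `u_att`, that is, it sets `[B_att] = 0`. -/
def postDoS {X D T : Type*} (Bs : StructuredMatrix X (D ⊕ T)) : StructuredMatrix X (D ⊕ T) :=
  Matrix.fromCols Bs.toCols₁ 0

/-- The system `ẋ = [A] x + [B_def] u_def + [B_att] u_att` is structurally resilient to a DoS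
attack: the system after the attack is structurally controllable. -/
def StructurallyResilientToDoS {X D T : Type*} [Fintype X] [Fintype D] [Fintype T]
    (As : StructuredMatrix X X) (Bs : StructuredMatrix X (D ⊕ T)) : Prop :=
  StructurallyControllable As (postDoS Bs)

/-- The directed graph `D([A])` on the state vertices: there is an edge `x_j → x_i` iff
`[A]_{ij} ≠ 0`. -/
def stateDigraph {X : Type*} (As : StructuredMatrix X X) : Digraph X where
  Adj j i := As i j ≠ 0

/-- The subgraph of `G` induced on the (non-empty) vertex set `S` is strongly connected: any two
vertices of `S` are joined by a directed path all of whose vertices lie in `S`. -/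
def IsStronglyConnectedOn {V : Type*} (G : Digraph V) (S : Set V) : Prop :=
  S.Nonempty ∧
    ∀ v ∈ S, ∀ w ∈ S, Relation.ReflTransGen (fun a b => a ∈ S ∧ b ∈ S ∧ G.Adj a b) v w

/-- `S` is the vertex set of a strongly connected component of `G`. -/
def IsSCC {V : Type*} (G : Digraph V) (S : Set V) : Prop :=
  Maximal (IsStronglyConnectedOn G) S

/-- `S` is a non-top-linked SCC of `G`: an SCC without incoming edges from vertices of another
SCC, that is, from vertices outside `S` (every vertex lies in exactly one SCC). -/
def IsNonTopLinkedSCC {V : Type*} (G : Digraph V) (S : Set V) : Prop :=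
  IsSCC G S ∧ ∀ v, v ∉ S → ∀ w ∈ S, ¬ G.Adj v w

/-- The edges of the bipartite graph `B([H])`, whose left vertices are the columns and whose right
vertices are the rows of `[H]`: the left vertex `j` is joined to the right vertex `i` iff
`[H]_{ij} ≠ 0`. -/
def bipartiteEdges {m n : Type*} (Hs : StructuredMatrix m n) : Set (n × m) :=
  {e | Hs e.2 e.1 ≠ 0}

/-- A matching of `B([H])`: a set of edges no two of which share a (left or right) vertex. -/
def IsBipartiteMatching {m n : Type*} (Hs : StructuredMatrix m n) (M : Finset (n × m)) : Prop :=
  (∀ e ∈ M, e ∈ bipartiteEdges Hs) ∧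
    ∀ e ∈ M, ∀ f ∈ M, e ≠ f → e.1 ≠ f.1 ∧ e.2 ≠ f.2

/-- A maximum matching of `B([H])`: a matching with the largest number of edges. -/
def IsMaximumMatching {m n : Type*} (Hs : StructuredMatrix m n) (M : Finset (n × m)) : Prop :=
  IsBipartiteMatching Hs M ∧ ∀ M' : Finset (n × m), IsBipartiteMatching Hs M' → M'.card ≤ M.card

/-- The right vertex `i` is unmatched by `M`: it is on no edge of `M`. -/
def IsRightUnmatched {m n : Type*} (M : Finset (n × m)) (i : m) : Prop :=
  ∀ e ∈ M, e.2 ≠ i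

end

/-!
Blocking the attacker's inputs leaves only zero columns in the attacker's block, and zero columns
contribute nothing to `B u`; hence resilience is the same as structural controllability of
`([A], [B_def])` (`structurallyControllable_postDoS_iff`). It remains to see that this already forces
the two graph conditions, using that no input of the defender acts on a state of `Xatt`.

* Matching. A covector annihilating the columns of `A` and of `B` is constant along trajectories, so
  for a controllable pair the rows of `[A B]` are linearly independent
  (`Controllable.linearIndependent_row`). By Hall's theorem the rows can then be matched
  injectively to columns carrying nonzero entries
  (`exists_injective_ne_zero_of_linearIndependent_row`). The edges that use columns of `A` form a
  matching of `B([A])`, and every row it misses is matched to a column of `B`, so it is not in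
  `Xatt`. Some maximum matching covers all the rows that this matching covers
  (`IsBipartiteMatching.exists_isMaximumMatching_covering`).

* Components. If no edge enters `S` and no input acts on `S`, the coordinates in `S` solve an
  autonomous linear equation, so they vanish for all time once they vanish at time `0`
  (`Controllable.not_isolated`).
-/

/-! ### Removing blocked inputs -/

theorem structurallyControllable_postDoS_iff {X D T : Type*} [Fintype X] [Fintype D] [Fintype T]
    (As : StructuredMatrix X X) (Bs : StructuredMatrix X (D ⊕ T)) :
    StructurallyControllable As (postDoS Bs) ↔ StructurallyControllable As Bs.toCols₁ := by
  constructor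
  · rintro ⟨A, B, hA, hB, hc⟩
    refine ⟨A, B.toCols₁, hA, fun i j h => hB i (Sum.inl j) h, fun tf htf x₀ x₁ => ?_⟩
    obtain ⟨u, x, hu, hx, h0, h1⟩ := hc tf htf x₀ x₁
    refine ⟨fun t j => u t (Sum.inl j), x, ?_, fun t ht => ?_, h0, h1⟩
    · exact continuousOn_pi.2 fun j => continuousOn_pi.1 hu (Sum.inl j)
    · have hBu : B.mulVec (u t) = B.toCols₁.mulVec (fun j => u t (Sum.inl j)) := by
        funext i
        have hz : ∀ j : T, B i (Sum.inr j) = 0 := fun j => hB i (Sum.inr j) rfl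
        simp [Matrix.mulVec, dotProduct, Fintype.sum_sum_type, hz]
      rw [← hBu]
      exact hx t ht
  · rintro ⟨A, B, hA, hB, hc⟩
    refine ⟨A, Matrix.fromCols B 0, hA, ?_, fun tf htf x₀ x₁ => ?_⟩
    · rintro i (j | j) h
      · exact hB i j h
      · rfl
    obtain ⟨u, x, hu, hx, h0, h1⟩ := hc tf htf x₀ x₁
    refine ⟨fun t => Sum.elim (u t) 0, x, ?_, fun t ht => ?_, h0, h1⟩
    · refine continuousOn_pi.2 ?_
      rintro (j | j)
      · exact continuousOn_pi.1 hu j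
      · exact continuousOn_const
    · simpa [Matrix.fromCols_mulVec] using hx t ht

/-! ### Two necessary conditions for controllability -/

/-- The necessity of the Popov–Belevitch–Hautus condition at the eigenvalue `0`. The coefficients of
a linear relation between the rows of `[A B]` define a functional of the state that is conserved by
all trajectories. -/
theorem Controllable.linearIndependent_row {X U : Type*} [Fintype X] [Fintype U]
    {A : Matrix X X ℝ} {B : Matrix X U ℝ} (hc : Controllable A B) :
    LinearIndependent ℝ (Matrix.fromCols A B).row := by
  rw [Fintype.linearIndependent_iff]
  intro g hg
  have hgA : Matrix.vecMul g A = 0 := by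
    funext j
    simpa [Matrix.vecMul, dotProduct, Finset.sum_apply, Matrix.row] using congrFun hg (Sum.inl j)
  have hgB : Matrix.vecMul g B = 0 := by
    funext j
    simpa [Matrix.vecMul, dotProduct, Finset.sum_apply, Matrix.row] using congrFun hg (Sum.inr j)
  obtain ⟨u, x, -, hx, h0, h1⟩ := hc 1 one_pos 0 g
  have hderiv : ∀ t ∈ Icc (0 : ℝ) 1,
      HasDerivWithinAt (fun t => g ⬝ᵥ x t) 0 (Icc 0 1) t := by
    intro t ht
    have hsum : HasDerivWithinAt (fun t => ∑ i, g i * x t i)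
        (∑ i, g i * (A.mulVec (x t) + B.mulVec (u t)) i) (Icc 0 1) t :=
      HasDerivWithinAt.fun_sum fun i _ =>
        ((hasDerivWithinAt_pi.1 (hx t ht)) i).const_mul (g i)
    have hz : ∑ i, g i * (A.mulVec (x t) + B.mulVec (u t)) i = 0 := by
      change g ⬝ᵥ (A.mulVec (x t) + B.mulVec (u t)) = 0
      rw [dotProduct_add, Matrix.dotProduct_mulVec, Matrix.dotProduct_mulVec, hgA, hgB]
      simp
    rw [hz] at hsum
    exact hsum
  have hconst : g ⬝ᵥ x 1 = g ⬝ᵥ x 0 := by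
    refine constant_of_has_deriv_right_zero (fun t ht => (hderiv t ht).continuousWithinAt)
      (fun t ht => ?_) 1 (right_mem_Icc.2 zero_le_one)
    exact ((hderiv t (Ico_subset_Icc_self ht)).mono_of_mem_nhdsWithin
      (Icc_mem_nhdsGE_of_mem ht))
  rw [h0, h1, dotProduct_zero] at hconst
  exact fun i => congrFun (dotProduct_self_eq_zero.1 hconst) i

/-- A non-empty set of states whose dynamics involve neither the other states nor the inputs cannot
be steered away from the origin. -/
theorem Controllable.not_isolated {X U : Type*} [Fintype X] [Fintype U]
    {A : Matrix X X ℝ} {B : Matrix X U ℝ} (hc : Controllable A B) {S : Set X} (hS : S.Nonempty)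
    (hA : ∀ i ∈ S, ∀ j ∉ S, A i j = 0) (hB : ∀ i ∈ S, ∀ j, B i j = 0) : False := by
  classical
  obtain ⟨s, hs⟩ := hS
  obtain ⟨u, x, -, hx, h0, h1⟩ := hc 1 one_pos 0 1
  -- The part `y` of the trajectory in `S` is a solution of `y' = C y`, as is the zero function.
  let C : Matrix X X ℝ := fun i j => if i ∈ S then A i j else 0
  let y : ℝ → X → ℝ := fun t i => if i ∈ S then x t i else 0
  have hy : ∀ t ∈ Icc (0 : ℝ) 1, HasDerivWithinAt y (C.mulVec (y t)) (Icc 0 1) t := by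
    intro t ht
    refine hasDerivWithinAt_pi.2 fun i => ?_
    by_cases hi : i ∈ S
    · have h := hasDerivWithinAt_pi.1 (hx t ht) i
      have hval : (A.mulVec (x t) + B.mulVec (u t)) i = C.mulVec (y t) i := by
        simp only [Pi.add_apply, Matrix.mulVec, dotProduct, hB i hi, zero_mul,
          Finset.sum_const_zero, add_zero, C, y, if_pos hi]
        refine Finset.sum_congr rfl fun j _ => ?_
        by_cases hj : j ∈ S
        · rw [if_pos hj]
        · rw [hA i hi j hj, zero_mul, zero_mul]
      rw [hval] at h
      simpa only [y, if_pos hi] using h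
    · have hval : C.mulVec (y t) i = 0 := by
        simp [Matrix.mulVec, dotProduct, C, hi]
      rw [hval]
      simpa only [y, if_neg hi] using hasDerivWithinAt_const t (Icc (0 : ℝ) 1) (0 : ℝ)
  have hlip : LipschitzWith _ (fun z : X → ℝ => C.mulVec z) :=
    (LinearMap.toContinuousLinearMap C.mulVecLin).lipschitz
  have hyz : EqOn y (fun _ => 0) (Icc 0 1) := by
    refine ODE_solution_unique (v := fun _ z => C.mulVec z) (fun _ => hlip)
      (fun t ht => (hy t ht).continuousWithinAt)
      (fun t ht => (hy t (Ico_subset_Icc_self ht)).mono_of_mem_nhdsWithin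
        (Icc_mem_nhdsGE_of_mem ht))
      continuousOn_const (fun t _ => ?_) ?_
    · simpa using hasDerivWithinAt_const t (Ici t) (0 : X → ℝ)
    · funext i
      simp [y, h0]
  have h := congrFun (hyz (right_mem_Icc.2 zero_le_one)) s
  simp [y, hs, h1] at h

/-! ### Matchings -/

/-- The rows in a set `R` are supported on the columns adjacent to `R`, so `R` has at most as many
elements as there are such columns: this is Hall's condition. -/
theorem exists_injective_ne_zero_of_linearIndependent_row {m n : Type*} [Fintype n]
    {H : Matrix m n ℝ} (hH : LinearIndependent ℝ H.row) :
    ∃ f : m → n, Function.Injective f ∧ ∀ i, H i (f i) ≠ 0 := by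
  classical
  let t : m → Finset n := fun i => Finset.univ.filter fun j => H i j ≠ 0
  suffices h : ∃ f : m → n, Function.Injective f ∧ ∀ i, f i ∈ t i by
    simpa [t] using h
  refine (Finset.all_card_le_biUnion_card_iff_exists_injective t).1 fun R => ?_
  have hR : LinearIndependent ℝ (fun i : R => fun j : R.biUnion t => H i j) := by
    have hsub : LinearIndependent ℝ (fun i : R => H.row i) :=
      hH.comp (fun i : R => (i : m)) Subtype.val_injective
    rw [Fintype.linearIndependent_iff] at hsub ⊢
    intro g hg
    refine hsub g (funext fun j => ?_)
    by_cases hj : j ∈ R.biUnion t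
    · simpa [Finset.sum_apply, Matrix.row] using congrFun hg ⟨j, hj⟩
    · have hz : ∀ i : R, H i j = 0 := by
        intro i
        by_contra hne
        exact hj (Finset.mem_biUnion.2 ⟨i, i.2, by simpa [t] using hne⟩)
      simp [Finset.sum_apply, Matrix.row, hz]
  simpa only [Module.finrank_fintype_fun_eq_card, Fintype.card_coe] using
    hR.fintype_card_le_finrank

theorem exists_isMaximumMatching {m n : Type*} [Finite m] [Finite n]
    (Hs : StructuredMatrix m n) : ∃ M, IsMaximumMatching Hs M := by
  obtain ⟨M, hM, hmax⟩ := (Set.toFinite {M | IsBipartiteMatching Hs M}).exists_maximalFor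
    Finset.card _ ⟨∅, by simp [IsBipartiteMatching]⟩
  exact ⟨M, hM, fun M' hM' => (le_total M'.card M.card).elim id fun h => hmax hM' h⟩

/-- Adding an edge whose right vertex is unmatched, at the expense of the edges at its left
vertex, gives a matching. -/
theorem IsBipartiteMatching.insert_filter {m n : Type*} [DecidableEq m] [DecidableEq n]
    {Hs : StructuredMatrix m n} {M : Finset (n × m)} (hM : IsBipartiteMatching Hs M) {e : n × m}
    (he : e ∈ bipartiteEdges Hs) (hu : IsRightUnmatched M e.2) :
    IsBipartiteMatching Hs (insert e (M.filter fun f => f.1 ≠ e.1)) := by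
  constructor
  · intro f hf
    rcases Finset.mem_insert.1 hf with rfl | hf
    · exact he
    · exact hM.1 f (Finset.mem_filter.1 hf).1
  · intro f hf g hg hfg
    simp only [Finset.mem_insert, Finset.mem_filter] at hf hg
    rcases hf with rfl | ⟨hf, hf1⟩ <;> rcases hg with rfl | ⟨hg, hg1⟩
    · exact absurd rfl hfg
    · exact ⟨hg1.symm, (hu g hg).symm⟩
    · exact ⟨hf1, hu f hf⟩
    · exact hM.2 f hf g hg hfg

/-- Every matching `M` is dominated by a maximum matching, in the sense of the right vertices
covered. A maximum matching that shares as many edges as possible with `M` will do: if it missed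
the right vertex of an edge `e` of `M`, then trading its edge at the left vertex of `e` for `e`
would increase the overlap. -/
theorem IsBipartiteMatching.exists_isMaximumMatching_covering {m n : Type*} [Finite m] [Finite n]
    {Hs : StructuredMatrix m n} {M : Finset (n × m)} (hM : IsBipartiteMatching Hs M) :
    ∃ N, IsMaximumMatching Hs N ∧ ∀ i, IsRightUnmatched N i → IsRightUnmatched M i := by
  classical
  obtain ⟨N, hN, hmax⟩ := (Set.toFinite {N | IsMaximumMatching Hs N}).exists_maximalFor
    (fun N => (N ∩ M).card) _ (exists_isMaximumMatching Hs)
  refine ⟨N, hN, ?_⟩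
  rintro _ hi e he rfl
  set K := N.filter fun f => f.1 ≠ e.1
  have heN : e ∉ N := fun h => hi e h rfl
  have hK : IsBipartiteMatching Hs (insert e K) := hN.1.insert_filter (hM.1 e he) hi
  have heK : e ∉ K := fun h => heN (Finset.mem_filter.1 h).1
  have hcard : N.card ≤ (insert e K).card := by
    -- The matching `N` has at most one edge at the left vertex of `e`.
    have hle : (N.filter fun f => ¬ f.1 ≠ e.1).card ≤ 1 := by
      refine Finset.card_le_one.2 fun f hf g hg => ?_
      simp only [Finset.mem_filter, not_not] at hf hg
      by_contra hne
      exact (hN.1.2 f hf.1 g hg.1 hne).1 (hf.2.trans hg.2.symm)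
    rw [Finset.card_insert_of_notMem heK]
    have hadd : K.card + (N.filter fun f => ¬ f.1 ≠ e.1).card = N.card :=
      Finset.card_filter_add_card_filter_not (s := N) (fun f => f.1 ≠ e.1)
    omega
  have hKmax : IsMaximumMatching Hs (insert e K) := ⟨hK, fun M' hM' => (hN.2 M' hM').trans hcard⟩
  have hlt : (N ∩ M).card < (insert e K ∩ M).card := by
    refine Finset.card_lt_card (Finset.ssubset_iff_of_subset ?_ |>.2 ⟨e, ?_, ?_⟩)
    · intro f hf
      obtain ⟨hfN, hfM⟩ := Finset.mem_inter.1 hf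
      have hne : f ≠ e := fun h => heN (h ▸ hfN)
      exact Finset.mem_inter.2 ⟨Finset.mem_insert_of_mem
        (Finset.mem_filter.2 ⟨hfN, (hM.2 f hfM e he hne).1⟩), hfM⟩
    · exact Finset.mem_inter.2 ⟨Finset.mem_insert_self _ _, he⟩
    · exact fun h => heN (Finset.mem_inter.1 h).1
  exact absurd (hmax hKmax hlt.le) (not_le.2 hlt)

/-! ### Graph conditions for structural controllability -/

theorem StructurallyControllable.exists_isMaximumMatching {X U : Type*} [Fintype X] [Fintype U]
    {As : StructuredMatrix X X} {Bs : StructuredMatrix X U} (h : StructurallyControllable As Bs) :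
    ∃ M, IsMaximumMatching As M ∧ ∀ i, IsRightUnmatched M i → ∃ j, Bs i j ≠ 0 := by
  classical
  obtain ⟨A, B, hA, hB, hc⟩ := h
  obtain ⟨f, hf, hne⟩ := exists_injective_ne_zero_of_linearIndependent_row hc.linearIndependent_row
  let M : Finset (X × X) := Finset.univ.filter fun e => f e.2 = Sum.inl e.1
  have hM : IsBipartiteMatching As M := by
    constructor
    · intro e he hz
      have hfe : f e.2 = Sum.inl e.1 := (Finset.mem_filter.1 he).2
      refine hne e.2 ?_
      rw [hfe]
      exact hA _ _ hz
    · intro e he e' he' hee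
      have h1 : f e.2 = Sum.inl e.1 := (Finset.mem_filter.1 he).2
      have h2 : f e'.2 = Sum.inl e'.1 := (Finset.mem_filter.1 he').2
      refine ⟨fun h => hee (Prod.ext h (hf ?_)), fun h => hee (Prod.ext ?_ h)⟩
      · rw [h1, h2, h]
      · rw [h, h2] at h1
        exact (Sum.inl_injective h1).symm
  obtain ⟨N, hN, hcov⟩ := hM.exists_isMaximumMatching_covering
  refine ⟨N, hN, fun i hi => ?_⟩
  rcases hfi : f i with j | j
  · exact absurd rfl (hcov i hi (j, i) (Finset.mem_filter.2 ⟨Finset.mem_univ _, hfi⟩))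
  · refine ⟨j, fun hz => hne i ?_⟩
    rw [hfi]
    exact hB _ _ hz

theorem StructurallyControllable.exists_input_of_isNonTopLinkedSCC {X U : Type*} [Fintype X]
    [Fintype U] {As : StructuredMatrix X X} {Bs : StructuredMatrix X U}
    (h : StructurallyControllable As Bs) {S : Set X}
    (hS : IsNonTopLinkedSCC (stateDigraph As) S) : ∃ i ∈ S, ∃ j, Bs i j ≠ 0 := by
  obtain ⟨A, B, hA, hB, hc⟩ := h
  by_contra! hcon
  exact hc.not_isolated hS.1.prop.1
    (fun i hi j hj => hA i j (not_not.1 (hS.2 j hj i hi)))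
    (fun i hi j => hB i j (hcon i hi j))

/-- `Xdef` and `Xatt` are the (disjoint) sets of states that the defender's inputs, respectively
the attacker's inputs, may be connected to. -/
theorem mainTheorem1 (n d a : ℕ)
    (As : StructuredMatrix (Fin n) (Fin n))
    (Bs : StructuredMatrix (Fin n) (Fin d ⊕ Fin a))
    (Xdef Xatt : Set (Fin n))
    (hdisj : Disjoint Xdef Xatt)
    (hdef : ∀ (i : Fin n) (j : Fin d), Bs.toCols₁ i j ≠ 0 → i ∈ Xdef)
    (hatt : ∀ (i : Fin n) (j : Fin a), Bs.toCols₂ i j ≠ 0 → i ∈ Xatt) :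
    StructurallyResilientToDoS As Bs ↔
      StructurallyControllable As Bs.toCols₁ ∧
      (∃ M : Finset (Fin n × Fin n), IsMaximumMatching As M ∧
        ∀ i : Fin n, IsRightUnmatched M i → i ∉ Xatt) ∧
      ¬ ∃ S : Set (Fin n), IsNonTopLinkedSCC (stateDigraph As) S ∧ S ⊆ Xatt := by
  refine (structurallyControllable_postDoS_iff As Bs).trans ⟨fun h => ⟨h, ?_, ?_⟩, fun h => h.1⟩
  · obtain ⟨M, hM, hcov⟩ := h.exists_isMaximumMatching
    refine ⟨M, hM, fun i hi hiatt => ?_⟩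
    obtain ⟨j, hj⟩ := hcov i hi
    exact disjoint_left.1 hdisj (hdef i j hj) hiatt
  · rintro ⟨S, hS, hSatt⟩
    obtain ⟨i, hi, j, hj⟩ := h.exists_input_of_isNonTopLinkedSCC hS
    exact disjoint_left.1 hdisj (hdef i j hj) (hSatt hi)
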